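/- Let $p>3$ be a prime, let $\mathbb Z_p$ be the ring of $p$-adic integers, and let $x\in\mathbb Z_p$. For $k\in\mathbb N=\{0,1,2,\ldots\}$ write $\binom xk=x(x-1)\cdots(x-k+1)/k!$, and for $n\in\mathbb N$ put $$s_n(x)=\sum_{k=0}^n\binom nk\binom xk\binom{-1-x}k(-1)^k.$$ Then $$\sum_{k=0}^{p-1}s_k(x)\sum_{j=0}^{p-1}\binom xj\binom{-1-x}j\binom{k+j}j\equiv\sum_{k=0}^{p-1}\binom xk\binom{-1-x}k\frac p{2k+1}\pmod{p^3},$$ that is, the difference of the two sides belongs to $p^3\mathbb Z_p$. -/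

import Mathlib

/-- The polynomial `S_n(x, y) = ∑_{k=0}^n C(n,k) C(x,k) C(-1-x,k) y^k`, evaluated in a ring where
the binomial coefficients `C(r, k) = r(r-1)⋯(r-k+1)/k!` make sense (e.g. the `p`-adic integers). -/
noncomputable def bigS {R : Type*} [CommRing R] [BinomialRing R] (n : ℕ) (x y : R) : R :=
  ∑ k ∈ Finset.range (n + 1),
    (n.choose k : R) * Ring.choose x k * Ring.choose (-1 - x) k * y ^ k

/-- `s_n(x) = S_n(x, -1)`. -/
noncomputable def smallS {R : Type*} [CommRing R] [BinomialRing R] (n : ℕ) (x : R) : R :=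
  bigS n x (-1)

/-- Congruence of `p`-adic numbers modulo `p ^ m`: the difference lies in `p ^ m ℤ_p`. -/
def PadicModEq (p : ℕ) [Fact p.Prime] (m : ℕ) (a b : ℚ_[p]) : Prop :=
  ∃ c : ℤ_[p], a - b = (p : ℚ_[p]) ^ m * (c : ℚ_[p])

/-!
Write `aₖ = C(x, k) C(-1 - x, k)`. Exchanging sums and using
`∑_{k < p} C(k, i) C(k + j, j) = C(i + j, i) C(p + j, i + j + 1)`, the left-hand side becomes
`∑_{i, j < p} aᵢ aⱼ p / (i + j + 1) · ∏_{1 ≤ m ≤ j} (1 + p / m) ∏_{1 ≤ m ≤ i} (1 - p / m)`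
(`neg_one_pow_mul_choose_mul_choose_eq`).
After symmetrizing in `i` and `j`, the products equal `1` modulo `p ^ 2`, which suffices where
`p / (i + j + 1)` is divisible by `p`. In the remaining case `i + j = p - 1` they equal `1` even
modulo `p ^ 3`, because the harmonic sums `∑ 1 / m` and `∑ 1 / m ^ 2` over all nonzero residues
vanish modulo `p` (`dvd_sum_invSucc_reflect`). Hence the left-hand side is congruent to
`∑_{i, j < p} aᵢ aⱼ p / (i + j + 1)` (`prime_pow_three_dvd_sum_sub`).

It remains to compare this sum with `∑_{k < p} aₖ p / (2 k + 1)`. Their difference is a polynomial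
`D` in `x` over `ℤ_[p]` (`diffPoly`). For an integer `0 ≤ n < p`, both sums are integrals of
Legendre polynomials and equal `p / (2 n + 1)`, so `D` vanishes at `n`, and by the symmetry
`x ↦ -1 - x` also at `-1 - n`. Thus `D = M Q` with `M = ∏_{-p ≤ m < p} (X - m)`, which is monic of
degree `2 p`. Modulo `p` the degree of `D` is at most `2 p - 2`, which forces `p ∣ Q`. Since
`p ^ 2 ∣ M(x)` for every `x`, it follows that `p ^ 3 ∣ D(x)` (`prime_pow_three_dvd_eval_diffPoly`).
-/

/-! ### Partial fractions and integrals of Legendre polynomials -/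

open Finset in
theorem prod_range_erase_sub {K : Type*} [Field K] {n i : ℕ} (hi : i ≤ n) :
    ∏ j ∈ (range (n + 1)).erase i, ((j : K) - i) = (-1) ^ i * (i.factorial * (n - i).factorial) := by
  have h1 : (range (n + 1)).erase i = range i ∪ Ico (i + 1) (n + 1) := by
    ext j; simp; omega
  have hd : Disjoint (range i) (Ico (i + 1) (n + 1)) := by
    rw [Finset.disjoint_left]; intro j; simp; omega
  rw [h1, prod_union hd, prod_Ico_eq_prod_range, ← prod_range_reflect, ← mul_assoc]
  congr 1
  · rw [← Finset.prod_range_add_one_eq_factorial, Nat.cast_prod, ← card_range i, ← prod_const,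
      card_range, ← prod_mul_distrib]
    refine prod_congr rfl fun j hj => ?_
    rw [mem_range] at hj
    rw [Nat.sub_sub, Nat.cast_sub (by omega)]
    push_cast; ring
  · rw [← Finset.prod_range_add_one_eq_factorial, Nat.cast_prod, show n + 1 - (i + 1) = n - i by omega]
    refine prod_congr rfl fun j _ => ?_
    push_cast; ring

open Finset Polynomial in
/-- The partial fraction decomposition of `∏_{m=1}^n (z - m) / ∏_{m=0}^n (z + m)`, obtained by
Lagrange interpolation of the numerator at the poles `0, -1, …, -n`. -/
theorem sum_choose_mul_choose_div_add {K : Type*} [Field K] [CharZero K] (n : ℕ) (z : K)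
    (hz : ∀ i ∈ range (n + 1), z + i ≠ 0) :
    ∑ i ∈ range (n + 1), (-1) ^ i * (n.choose i : K) * (n + i).choose i / (z + i) =
      (-1) ^ n * (∏ m ∈ range n, (z - (m + 1))) / ∏ m ∈ range (n + 1), (z + m) := by
  set v : ℕ → K := fun i => -(i : K) with hv
  have hinj : Set.InjOn v (range (n + 1)) := fun a _ b _ h => by simpa [hv] using h
  set f : K[X] := ∏ m ∈ range n, (X - C ((m : K) + 1)) with hf
  have hdeg : f.degree < #(range (n + 1)) := by
    rw [hf, degree_prod]
    simp only [degree_X_sub_C, sum_const, card_range, nsmul_eq_mul, mul_one]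
    exact_mod_cast Nat.lt_succ_self n
  have hfe : ∀ y, f.eval y = ∏ m ∈ range n, (y - (m + 1)) := fun y => by
    simp [hf, eval_prod]
  have h := Lagrange.eq_interpolate hinj hdeg
  have hx : ∀ i ∈ range (n + 1), z ≠ v i := fun i hi h => hz i hi (by rw [h]; simp [hv])
  have h2 := Lagrange.eval_interpolate_not_at_node (r := fun i => f.eval (v i)) hx
  rw [← h, hfe, Lagrange.eval_nodal] at h2
  have hne : ∏ m ∈ range (n + 1), (z + m) ≠ 0 := prod_ne_zero_iff.mpr hz
  simp only [hv, sub_neg_eq_add] at h2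
  rw [h2, mul_left_comm, mul_div_cancel_left₀ _ hne]
  rw [mul_sum]
  refine sum_congr rfl fun i hi => ?_
  have hin : i ≤ n := by simpa [Nat.lt_succ_iff] using hi
  have hzi := hz i hi
  have hw : Lagrange.nodalWeight (range (n + 1)) (fun i : ℕ => -(i : K)) i =
      ((-1 : K) ^ i * (i.factorial * (n - i).factorial))⁻¹ := by
    rw [Lagrange.nodalWeight, ← prod_range_erase_sub hin, prod_inv_distrib]
    congr 1
    refine prod_congr rfl fun j _ => ?_
    ring
  have hev : f.eval (-(i : K)) = (-1) ^ n * ((n + i).factorial / i.factorial) := by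
    have h3 : ((n + i).factorial : K) = i.factorial * ∏ m ∈ range n, ((i : K) + (m + 1)) := by
      rw [add_comm n i, ← Nat.factorial_mul_ascFactorial, Nat.ascFactorial_eq_prod_range,
        Nat.cast_mul, Nat.cast_prod]
      congr 1
      exact prod_congr rfl fun j _ => by push_cast; ring
    have hi0 : (i.factorial : K) ≠ 0 := by exact_mod_cast i.factorial_ne_zero
    rw [h3, mul_div_cancel_left₀ _ hi0, hfe]
    conv_rhs => rw [← card_range n, ← prod_const, card_range, ← prod_mul_distrib]
    exact prod_congr rfl fun j _ => by ring
  rw [hw, hev, Nat.cast_choose K hin, Nat.cast_choose K (Nat.le_add_left i n), Nat.add_sub_cancel]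
  have hi0 : (i.factorial : K) ≠ 0 := by exact_mod_cast i.factorial_ne_zero
  have hn0 : (n.factorial : K) ≠ 0 := by exact_mod_cast n.factorial_ne_zero
  have hni0 : ((n - i).factorial : K) ≠ 0 := by exact_mod_cast (n - i).factorial_ne_zero
  have h1 : ((-1 : K) ^ n) * (-1) ^ n = 1 := by rw [← mul_pow]; simp
  have h1i : ((-1 : K) ^ i)⁻¹ = (-1) ^ i := by rw [← inv_pow]; norm_num
  rw [mul_inv, h1i]
  field_simp
  linear_combination (-((n + i).factorial : K)) * h1

open Finset in
/-- The algebraic form of `∫₀¹ P_n(1 - 2t)² dt = 1 / (2n + 1)` for the Legendre polynomial `P_n`. -/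
theorem sum_choose_mul_choose_div_add_add_one {K : Type*} [Field K] [CharZero K] (n : ℕ) :
    ∑ j ∈ range (n + 1), ∑ i ∈ range (n + 1),
      ((-1) ^ i * (n.choose i : K) * (n + i).choose i) *
        ((-1) ^ j * (n.choose j : K) * (n + j).choose j) / (i + j + 1) = 1 / (2 * n + 1) := by
  have key : ∀ j : ℕ, ∑ i ∈ range (n + 1),
      ((-1) ^ i * (n.choose i : K) * (n + i).choose i) *
        ((-1) ^ j * (n.choose j : K) * (n + j).choose j) / (i + j + 1) =
      ((-1) ^ j * (n.choose j : K) * (n + j).choose j) *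
       ((-1) ^ n * (∏ m ∈ range n, ((j + 1 : K) - (m + 1))) /
        ∏ m ∈ range (n + 1), ((j + 1 : K) + m)) := by
    intro j
    rw [← sum_choose_mul_choose_div_add n (j + 1 : K)
      (fun i _ => by exact_mod_cast (by omega : j + 1 + i ≠ 0)), mul_sum]
    refine sum_congr rfl fun i _ => ?_
    rw [show (i : K) + j + 1 = j + 1 + i by ring]; ring
  simp only [key]
  -- At `z = j + 1` with `j < n` the numerator vanishes, so only `j = n` contributes.
  rw [sum_range_succ, sum_eq_zero, zero_add]
  · have h1 : ((-1 : K) ^ n) * (-1) ^ n = 1 := by rw [← mul_pow]; simp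
    have h2 : ∏ m ∈ range n, ((n + 1 : K) - (m + 1)) = n.factorial := by
      rw [← prod_range_add_one_eq_factorial, ← prod_range_reflect, Nat.cast_prod]
      refine prod_congr rfl fun m hm => ?_
      rw [mem_range] at hm
      rw [Nat.sub_sub, Nat.cast_sub (by omega)]
      push_cast; ring
    have h3 : (n.factorial : K) * ∏ m ∈ range (n + 1), ((n + 1 : K) + m) =
        (2 * n + 1) * (n + n).factorial := by
      have : n.factorial * ∏ m ∈ range (n + 1), (n + 1 + m) = (2 * n + 1) * (n + n).factorial := by
        rw [← Nat.ascFactorial_eq_prod_range, Nat.factorial_mul_ascFactorial, ← add_assoc,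
          Nat.factorial_succ, two_mul]
      exact_mod_cast this
    have hn0 : (n.factorial : K) ≠ 0 := by exact_mod_cast n.factorial_ne_zero
    have hd0 : ((n + n).factorial : K) ≠ 0 := by exact_mod_cast (n + n).factorial_ne_zero
    have hc0 : (2 * n + 1 : K) ≠ 0 := by exact_mod_cast (by omega : 2 * n + 1 ≠ 0)
    have hP : ∏ m ∈ range (n + 1), ((n + 1 : K) + m) ≠ 0 :=
      prod_ne_zero_iff.mpr fun m _ => by exact_mod_cast (by omega : n + 1 + m ≠ 0)
    rw [h2, Nat.choose_self, Nat.cast_choose K (Nat.le_add_left n n), Nat.add_sub_cancel]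
    rw [eq_div_iff hc0]
    field_simp
    rw [Nat.cast_one]
    linear_combination ((2 * n + 1) * (n + n).factorial : K) * h1 - h3
  · intro j hj
    rw [prod_eq_zero hj (by ring)]
    simp

open Finset in
/-- The algebraic form of `∫₀¹ P_n(1 - 2t²) dt = 1 / (2n + 1)` for the Legendre polynomial `P_n`. -/
theorem sum_choose_mul_choose_div_two_mul_add_one {K : Type*} [Field K] [CharZero K] (n : ℕ) :
    ∑ i ∈ range (n + 1), ((-1) ^ i * (n.choose i : K) * (n + i).choose i) / (2 * i + 1) =
      1 / (2 * n + 1) := by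
  have hk : ∀ k : ℕ, (1 / 2 : K) + k ≠ 0 := fun k h => by
    have h' : ((1 + 2 * k : ℕ) : K) = 0 := by push_cast; linear_combination 2 * h
    exact absurd (Nat.cast_eq_zero.mp h') (by omega)
  have h := sum_choose_mul_choose_div_add n (1 / 2 : K) (fun i _ => hk i)
  have hprod : (-1) ^ n * (∏ m ∈ range n, ((1 / 2 : K) - (m + 1))) =
      ∏ m ∈ range n, ((1 / 2 : K) + m) := by
    conv_lhs => rw [← card_range n, ← prod_const, card_range, ← prod_mul_distrib]
    exact prod_congr rfl fun m _ => by ring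
  rw [hprod, prod_range_succ, div_mul_cancel_left₀ (prod_ne_zero_iff.mpr fun m _ => hk m)] at h
  have hc : ∀ k : ℕ, (2 * k + 1 : K) = 2 * (1 / 2 + k) := fun k => by ring
  rw [hc n]
  rw [one_div, mul_inv, ← h, mul_sum]
  refine sum_congr rfl fun i _ => ?_
  rw [hc i, div_eq_mul_inv, div_eq_mul_inv, mul_inv]; ring

/-! ### Symmetrized products -/

open Finset in
/-- The expansion of `∏ (1 + t hₘ)` to second order in `t`. The second elementary symmetric
function `e` is chosen before `t`, so that the expansions at `t` and `-t` share it; this avoids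
dividing by `2` in `exists_twistedProd_add_swap_eq`. -/
theorem exists_forall_prod_one_add_mul_eq {R : Type*} [CommRing R] (h : ℕ → R) (n : ℕ) :
    ∃ e : R, 2 * e = (∑ m ∈ range n, h m) ^ 2 - ∑ m ∈ range n, h m ^ 2 ∧ ∀ t : R, ∃ c : R,
      ∏ m ∈ range n, (1 + t * h m) = 1 + t * ∑ m ∈ range n, h m + t ^ 2 * e + t ^ 3 * c := by
  induction n with
  | zero => exact ⟨0, by simp, fun t => ⟨0, by simp⟩⟩
  | succ n ih =>
    obtain ⟨e, he, hc⟩ := ih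
    refine ⟨e + (∑ m ∈ range n, h m) * h n, ?_, fun t => ?_⟩
    · rw [sum_range_succ, sum_range_succ]
      linear_combination he
    · obtain ⟨c, hc⟩ := hc t
      refine ⟨c + e * h n + t * c * h n, ?_⟩
      rw [prod_range_succ, hc, sum_range_succ]
      ring

/-- The product `∏_{m < j} (1 + t hₘ) ∏_{m < i} (1 - t hₘ)`. -/
noncomputable def twistedProd {R : Type*} [CommRing R] (t : R) (h : ℕ → R) (i j : ℕ) : R :=
  (∏ m ∈ Finset.range j, (1 + t * h m)) * ∏ m ∈ Finset.range i, (1 - t * h m)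

open Finset in
/-- Symmetrizing in `i, j` kills the term of order `t`; the term of order `t²` is a combination of
power sums. -/
theorem exists_twistedProd_add_swap_eq {R : Type*} [CommRing R] (t : R) (h : ℕ → R) (i j : ℕ) :
    ∃ c : R, twistedProd t h i j + twistedProd t h j i = 2 + t ^ 2 *
      ((∑ m ∈ range i, h m - ∑ m ∈ range j, h m) ^ 2 -
        (∑ m ∈ range i, h m ^ 2 + ∑ m ∈ range j, h m ^ 2)) + t ^ 3 * c := by
  obtain ⟨a, ha, hi⟩ := exists_forall_prod_one_add_mul_eq h i
  obtain ⟨b, hb, hj⟩ := exists_forall_prod_one_add_mul_eq h j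
  obtain ⟨c₁, hc₁⟩ := hi t
  obtain ⟨c₂, hc₂⟩ := hj t
  obtain ⟨c₃, hc₃⟩ := hi (-t)
  obtain ⟨c₄, hc₄⟩ := hj (-t)
  simp only [neg_mul, ← sub_eq_add_neg] at hc₃ hc₄
  unfold twistedProd
  rw [hc₁, hc₂, hc₃, hc₄]
  generalize ∑ m ∈ range i, h m = x at *
  generalize ∑ m ∈ range j, h m = y at *
  generalize ∑ m ∈ range i, h m ^ 2 = x₂ at *
  generalize ∑ m ∈ range j, h m ^ 2 = y₂ at *
  refine ⟨2 * t * a * b + c₂ * (1 - t * x + t ^ 2 * a - t ^ 3 * c₃) - c₃ * (1 + t * y + t ^ 2 * b)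
    + c₁ * (1 - t * y + t ^ 2 * b - t ^ 3 * c₄) - c₄ * (1 + t * x + t ^ 2 * a), ?_⟩
  linear_combination t ^ 2 * ha + t ^ 2 * hb

/-! ### The inverses of small integers in `ℤ_[p]` -/

section
variable {p : ℕ} [Fact p.Prime]

theorem padicInt_dvd_iff_toZMod_eq_zero (a : ℤ_[p]) : (p : ℤ_[p]) ∣ a ↔ PadicInt.toZMod a = 0 := by
  rw [← RingHom.mem_ker, PadicInt.ker_toZMod, PadicInt.maximalIdeal_eq_span_p,
    Ideal.mem_span_singleton]

theorem padicInt_isUnit_natCast {m : ℕ} (hm : ¬ p ∣ m) : IsUnit (m : ℤ_[p]) := by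
  rw [PadicInt.isUnit_iff]
  refine le_antisymm (PadicInt.norm_le_one _) (not_lt.mp fun h => hm ?_)
  have := (PadicInt.norm_int_lt_one_iff_dvd (p := p) (m : ℤ)).mp (by simpa using h)
  exact_mod_cast this

theorem natCast_mul_inverse {m : ℕ} (hm : ¬ p ∣ m) : (m : ℤ_[p]) * Ring.inverse (m : ℤ_[p]) = 1 :=
  Ring.mul_inverse_cancel _ (padicInt_isUnit_natCast hm)

/-- The inverse of `m + 1` in `ℤ_[p]`, with the junk value `0` when `p ∣ m + 1`. -/
noncomputable def invSucc (p : ℕ) [Fact p.Prime] (m : ℕ) : ℤ_[p] :=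
  Ring.inverse ((m + 1 : ℕ) : ℤ_[p])

theorem add_one_mul_invSucc {m : ℕ} (hm : m + 1 < p) : ((m : ℤ_[p]) + 1) * invSucc p m = 1 := by
  have := natCast_mul_inverse (Nat.not_dvd_of_pos_of_lt m.succ_pos hm)
  rw [invSucc]; push_cast at this ⊢; exact this

theorem toZMod_invSucc {m : ℕ} (hm : m + 1 < p) :
    PadicInt.toZMod (invSucc p m) = ((m : ZMod p) + 1)⁻¹ := by
  have := congrArg PadicInt.toZMod (add_one_mul_invSucc hm)
  simp only [map_mul, map_add, map_natCast, map_one] at this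
  exact eq_inv_of_mul_eq_one_right this

/-- The `p`-adic integer `p / (n + 1)`. The value is the correct one for `n + 1 < 2 * p`, where `p`
can divide `n + 1` only by being equal to it. -/
noncomputable def primeDivSucc (p : ℕ) [Fact p.Prime] (n : ℕ) : ℤ_[p] :=
  if n + 1 = p then 1 else p * invSucc p n

theorem dvd_primeDivSucc {n : ℕ} (hn : n + 1 ≠ p) : (p : ℤ_[p]) ∣ primeDivSucc p n := by
  rw [primeDivSucc, if_neg hn]; exact dvd_mul_right _ _

theorem add_one_mul_primeDivSucc {n : ℕ} (hn : n + 1 < 2 * p) :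
    ((n : ℤ_[p]) + 1) * primeDivSucc p n = p := by
  unfold primeDivSucc
  split_ifs with h
  · rw [mul_one]; exact_mod_cast h
  · have hd : ¬ p ∣ n + 1 := by
      rintro ⟨k, hk⟩
      have : k < 2 := by
        by_contra! h2
        nlinarith
      interval_cases k <;> omega
    have := natCast_mul_inverse hd
    rw [invSucc]
    push_cast at this ⊢
    linear_combination (p : ℤ_[p]) * this

theorem coe_primeDivSucc {n : ℕ} (hn : n + 1 < 2 * p) :
    (primeDivSucc p n : ℚ_[p]) = p / (n + 1) := by
  rw [eq_div_iff (by exact_mod_cast n.succ_ne_zero), mul_comm]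
  exact_mod_cast congrArg ((↑) : ℤ_[p] → ℚ_[p]) (add_one_mul_primeDivSucc hn)

open Finset in
theorem prod_one_add_mul_invSucc {j : ℕ} (hj : j < p) :
    ∏ m ∈ range j, (1 + (p : ℤ_[p]) * invSucc p m) = (p + j).choose j := by
  induction j with
  | zero => simp
  | succ j ih =>
    have h1 := add_one_mul_invSucc hj
    have h2 : ((p + j + 1 : ℕ) : ℤ_[p]) * (p + j).choose j = (p + j + 1).choose (j + 1) * (j + 1) := by
      exact_mod_cast Nat.add_one_mul_choose_eq (p + j) j
    rw [prod_range_succ, ih (by omega), ← add_assoc]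
    push_cast at h2
    linear_combination invSucc p j * h2 + (((p + j + 1).choose (j + 1) : ℤ_[p]) - (p + j).choose j) * h1

open Finset in
theorem prod_one_sub_mul_invSucc {i : ℕ} (hi : i < p) :
    ∏ m ∈ range i, (1 - (p : ℤ_[p]) * invSucc p m) = (-1) ^ i * (p - 1).choose i := by
  induction i with
  | zero => simp
  | succ i ih =>
    have h1 := add_one_mul_invSucc hi
    have h2 : ((p - 1).choose (i + 1) : ℤ_[p]) * (i + 1) = (p - 1).choose i * (p - 1 - i) := by
      have := congrArg (Nat.cast : ℕ → ℤ_[p]) (Nat.choose_succ_right_eq (p - 1) i)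
      rw [Nat.sub_sub, Nat.cast_mul, Nat.cast_mul, Nat.cast_sub (by omega)] at this
      push_cast at this
      linear_combination this
    rw [prod_range_succ, ih (by omega), pow_succ]
    linear_combination (-1) ^ i * (invSucc p i * h2 -
      (((p - 1).choose (i + 1) : ℤ_[p]) + (p - 1).choose i) * h1)

/-! ### The coefficients of the double sum -/

open Finset in
theorem sum_range_choose_mul_add_choose (n i j : ℕ) :
    ∑ k ∈ range n, k.choose i * (k + j).choose j = (i + j).choose i * (n + j).choose (i + j + 1) := by
  induction n with
  | zero => simp; right; apply Nat.choose_eq_zero_of_lt; omega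
  | succ n ih =>
    rw [sum_range_succ, ih, show n + 1 + j = n + j + 1 by omega, Nat.choose_succ_succ, mul_add,
      add_comm]
    congr 1
    rcases lt_or_ge n i with h | h
    · rw [Nat.choose_eq_zero_of_lt h, Nat.choose_eq_zero_of_lt (by omega : n + j < i + j)]; simp
    · have := Nat.choose_mul (n := n + j) (k := i + j) (s := j)
      rw [Nat.add_sub_cancel, Nat.add_sub_cancel, ← Nat.choose_symm_add (a := i) (b := j)] at this
      linarith [this (by omega)]

theorem add_choose_mul_choose_mul_add_one {q i j : ℕ} (hi : i < q) :
    (i + j).choose i * (q + j).choose (i + j + 1) * (i + j + 1) =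
      q * (q + j).choose j * (q - 1).choose i := by
  obtain ⟨r, rfl⟩ : ∃ r, q = i + r + 1 := ⟨q - i - 1, by omega⟩
  have h1 := Nat.add_choose_mul_factorial_mul_factorial i j
  have h2 := Nat.add_choose_mul_factorial_mul_factorial r (i + j + 1)
  have h3 := Nat.add_choose_mul_factorial_mul_factorial (i + r + 1) j
  have h4 := Nat.add_choose_mul_factorial_mul_factorial r i
  rw [show r + (i + j + 1) = i + r + 1 + j by omega, Nat.factorial_succ (i + j), ← h1] at h2
  rw [add_comm r i] at h4
  rw [Nat.factorial_succ (i + r), ← h4] at h3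
  rw [Nat.add_sub_cancel, Nat.choose_symm_add (a := i) (b := j)]
  have hpos : 0 < r.factorial * i.factorial * j.factorial := by positivity
  refine Nat.eq_of_mul_eq_mul_right hpos ?_
  linarith

/-! ### Harmonic sums modulo `p` and reduction of the double sum modulo `p ^ 3` -/

open Finset in
theorem sum_range_zmod {M : Type*} [AddCommMonoid M] (f : ZMod p → M) :
    ∑ m ∈ range p, f (m : ZMod p) = ∑ a : ZMod p, f a := by
  refine sum_bij (fun m _ => (m : ZMod p)) (fun _ _ => mem_univ _) ?_ ?_ (fun _ _ => rfl)
  · intro a ha b hb h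
    rw [mem_range] at ha hb
    rw [ZMod.natCast_eq_natCast_iff'] at h
    rwa [Nat.mod_eq_of_lt ha, Nat.mod_eq_of_lt hb] at h
  · intro b _
    exact ⟨b.val, mem_range.mpr b.val_lt, ZMod.natCast_zmod_val b⟩

open Finset in
theorem sum_range_inv_pow_zmod {k : ℕ} (hk : 0 < k) (hkp : k < p - 1) :
    ∑ m ∈ range (p - 1), ((m + 1 : ZMod p)⁻¹) ^ k = 0 := by
  have hp : p - 1 + 1 = p := Nat.sub_add_cancel (Fact.out : p.Prime).one_le
  have h := FiniteField.sum_pow_lt_card_sub_one (ZMod p) k (by rwa [ZMod.card])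
  rw [← Equiv.sum_comp (Equiv.inv (ZMod p)), ← sum_range_zmod, show range p = range (p - 1 + 1) by rw [hp],
    sum_range_succ'] at h
  simpa [hk.ne'] using h

open Finset in
/-- Power sums of inverses modulo `p` of lengths `i` and `p - 1 - i` are related by the reflection
`m ↦ p - m`, because the sum over all nonzero residues vanishes. -/
theorem sum_range_inv_pow_zmod_reflect {k i j : ℕ} (hk : 0 < k) (hkp : k < p - 1)
    (hij : i + j + 1 = p) :
    ∑ m ∈ range i, ((m + 1 : ZMod p)⁻¹) ^ k + (-1) ^ k * ∑ m ∈ range j, ((m + 1 : ZMod p)⁻¹) ^ k = 0 := by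
  rw [← sum_range_inv_pow_zmod hk hkp, show p - 1 = i + j by omega, sum_range_add]
  congr 1
  rw [← sum_range_reflect, mul_sum]
  refine sum_congr rfl fun m hm => ?_
  rw [mem_range] at hm
  rw [← mul_pow, Nat.sub_sub, Nat.cast_sub (by omega)]
  congr 1
  rw [neg_one_mul, ← inv_neg]
  congr 1
  have : ((i + j + 1 : ℕ) : ZMod p) = 0 := by rw [hij]; simp
  push_cast at this ⊢
  linear_combination (-1 : ZMod p) * this

open Finset in
/-- The vanishing modulo `p` of the second order term of the symmetrized `twistedProd` on the
antidiagonal `i + j = p - 1`, where `primeDivSucc` contributes no factor `p`. The power sums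
involved have exponents `1` and `2`, and `2 < p - 1` is where `3 < p` is needed. -/
theorem dvd_sum_invSucc_reflect (hp : 3 < p) {i j : ℕ} (hij : i + j + 1 = p) :
    (p : ℤ_[p]) ∣ (∑ m ∈ range i, invSucc p m - ∑ m ∈ range j, invSucc p m) ^ 2 -
        (∑ m ∈ range i, invSucc p m ^ 2 + ∑ m ∈ range j, invSucc p m ^ 2) := by
  have hred : ∀ n < p, ∀ k : ℕ, ∑ m ∈ range n, PadicInt.toZMod (invSucc p m) ^ k =
      ∑ m ∈ range n, ((m + 1 : ZMod p)⁻¹) ^ k := fun n hn k =>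
    sum_congr rfl fun m hm => by rw [toZMod_invSucc (by have := mem_range.mp hm; omega)]
  have h1 := sum_range_inv_pow_zmod_reflect (p := p) (k := 1) one_pos (by omega) hij
  have h2 := sum_range_inv_pow_zmod_reflect (p := p) (k := 2) two_pos (by omega) hij
  rw [← hred i (by omega), ← hred j (by omega)] at h1 h2
  simp only [pow_one] at h1
  rw [padicInt_dvd_iff_toZMod_eq_zero]
  simp only [map_sub, map_pow, map_add, map_sum]
  linear_combination (∑ m ∈ range i, PadicInt.toZMod (invSucc p m) -
    ∑ m ∈ range j, PadicInt.toZMod (invSucc p m)) * h1 - h2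

theorem neg_one_pow_mul_choose_mul_choose_eq {i j : ℕ} (hi : i < p) (hj : j < p) :
    (-1 : ℤ_[p]) ^ i * (((i + j).choose i * (p + j).choose (i + j + 1) : ℕ) : ℤ_[p]) =
      primeDivSucc p (i + j) * twistedProd (p : ℤ_[p]) (invSucc p) i j := by
  have h1 := add_one_mul_primeDivSucc (p := p) (n := i + j) (by omega)
  have h2 := congrArg (Nat.cast : ℕ → ℤ_[p]) (add_choose_mul_choose_mul_add_one (j := j) hi)
  have h0 : ((i + j : ℕ) : ℤ_[p]) + 1 ≠ 0 := by exact_mod_cast (i + j).succ_ne_zero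
  apply mul_left_cancel₀ h0
  rw [twistedProd, prod_one_add_mul_invSucc hj, prod_one_sub_mul_invSucc hi]
  push_cast at *
  linear_combination (-1) ^ i * h2 -
    ((p + j).choose j : ℤ_[p]) * ((-1) ^ i * (p - 1).choose i) * h1

theorem prime_pow_three_dvd_primeDivSucc_mul (hp : 3 < p) (i j : ℕ) :
    (p : ℤ_[p]) ^ 3 ∣ primeDivSucc p (i + j) * (twistedProd (p : ℤ_[p]) (invSucc p) i j +
      twistedProd (p : ℤ_[p]) (invSucc p) j i - 2) := by
  obtain ⟨c, hc⟩ := exists_twistedProd_add_swap_eq (p : ℤ_[p]) (invSucc p) i j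
  rw [hc]
  by_cases h : i + j + 1 = p
  · obtain ⟨d, hd⟩ := dvd_sum_invSucc_reflect hp h
    refine Dvd.dvd.mul_left ⟨d + c, ?_⟩ _
    rw [hd]; ring
  · obtain ⟨d, hd⟩ := dvd_primeDivSucc h
    rw [hd]
    exact ⟨d * ((∑ m ∈ Finset.range i, invSucc p m - ∑ m ∈ Finset.range j, invSucc p m) ^ 2 -
        (∑ m ∈ Finset.range i, invSucc p m ^ 2 + ∑ m ∈ Finset.range j, invSucc p m ^ 2) + p * c),
      by ring⟩

open Finset in
/-- The left-hand double sum is congruent to `∑ aᵢ aⱼ p / (i + j + 1)` modulo `p ^ 3`, whatever the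
coefficients `aᵢ`. -/
theorem prime_pow_three_dvd_sum_sub (hp : 3 < p) (a : ℕ → ℤ_[p]) :
    (p : ℤ_[p]) ^ 3 ∣ ∑ k ∈ range p, (∑ i ∈ range (k + 1), (k.choose i : ℤ_[p]) * a i * (-1) ^ i) *
          ∑ j ∈ range p, a j * ((k + j).choose j : ℤ_[p]) -
        ∑ i ∈ range p, ∑ j ∈ range p, a i * a j * primeDivSucc p (i + j) := by
  set P := twistedProd (p : ℤ_[p]) (invSucc p) with hP
  have h1 : ∑ k ∈ range p, (∑ i ∈ range (k + 1), (k.choose i : ℤ_[p]) * a i * (-1) ^ i) *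
          ∑ j ∈ range p, a j * ((k + j).choose j : ℤ_[p]) =
        ∑ i ∈ range p, ∑ j ∈ range p, a i * a j * (primeDivSucc p (i + j) * P i j) := by
    have hext : ∀ k ∈ range p, ∑ i ∈ range (k + 1), (k.choose i : ℤ_[p]) * a i * (-1) ^ i =
        ∑ i ∈ range p, (k.choose i : ℤ_[p]) * a i * (-1) ^ i := fun k hk => by
      refine sum_subset (range_mono (mem_range.mp hk)) fun i _ hi => ?_
      rw [Nat.choose_eq_zero_of_lt (by simpa [Nat.lt_succ_iff] using hi)]; simp
    rw [sum_congr rfl fun k hk => by rw [hext k hk, sum_mul_sum], sum_comm]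
    refine sum_congr rfl fun i hi => ?_
    rw [sum_comm]
    refine sum_congr rfl fun j hj => ?_
    rw [hP, ← neg_one_pow_mul_choose_mul_choose_eq (mem_range.mp hi) (mem_range.mp hj),
      ← sum_range_choose_mul_add_choose, Nat.cast_sum, mul_sum, mul_sum]
    refine sum_congr rfl fun k _ => ?_
    push_cast; ring
  have h2 : IsUnit ((2 : ℕ) : ℤ_[p]) :=
    padicInt_isUnit_natCast (Nat.not_dvd_of_pos_of_lt two_pos (by omega))
  rw [← h2.dvd_mul_left, h1, ← sum_sub_distrib]
  -- Twice the double sum is symmetrized in `i` and `j`; the factor `2` is a unit.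
  have hswap : ∑ i ∈ range p, ∑ j ∈ range p, a i * a j * (primeDivSucc p (i + j) * P i j) =
      ∑ i ∈ range p, ∑ j ∈ range p, a i * a j * (primeDivSucc p (i + j) * P j i) := by
    rw [sum_comm]
    refine sum_congr rfl fun i _ => sum_congr rfl fun j _ => ?_
    rw [add_comm j i]; ring
  have h3 : ((2 : ℕ) : ℤ_[p]) * ∑ i ∈ range p,
      (∑ j ∈ range p, a i * a j * (primeDivSucc p (i + j) * P i j) -
        ∑ j ∈ range p, a i * a j * primeDivSucc p (i + j)) =
      ∑ i ∈ range p, ∑ j ∈ range p,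
        a i * a j * (primeDivSucc p (i + j) * (P i j + P j i - 2)) := by
    rw [sum_sub_distrib, Nat.cast_two, two_mul]
    nth_rewrite 2 [hswap]
    simp only [← sum_add_distrib, ← sum_sub_distrib]
    refine sum_congr rfl fun i _ => sum_congr rfl fun j _ => ?_
    ring
  rw [h3]
  exact dvd_sum fun i _ => dvd_sum fun j _ =>
    Dvd.dvd.mul_left (prime_pow_three_dvd_primeDivSucc_mul hp i j) _

/-! ### The difference of the two sums as a polynomial in `x` -/

section
open Polynomial

/-- For `k < p`, the polynomial `C(X, k) C(-1 - X, k)` over `ℤ_[p]`. -/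
noncomputable def choosePoly (p : ℕ) [Fact p.Prime] (k : ℕ) : ℤ_[p][X] :=
  C (Ring.inverse ((k.factorial : ℕ) : ℤ_[p])) ^ 2 *
    (descPochhammer ℤ_[p] k * (descPochhammer ℤ_[p] k).comp (-1 - X))

theorem natDegree_choosePoly_le (k : ℕ) : (choosePoly p k).natDegree ≤ 2 * k := by
  have hX : (-1 - X : ℤ_[p][X]).natDegree ≤ 1 := by compute_degree
  rw [choosePoly, ← C_pow]
  refine (natDegree_C_mul_le _ _).trans (natDegree_mul_le.trans ?_)
  have h := natDegree_comp_le (p := descPochhammer ℤ_[p] k) (q := -1 - X)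
  rw [descPochhammer_natDegree] at h ⊢
  nlinarith

theorem eval_descPochhammer_eq_factorial_mul_choose (x : ℤ_[p]) (k : ℕ) :
    (descPochhammer ℤ_[p] k).eval x = k.factorial * Ring.choose x k := by
  rw [← nsmul_eq_mul, ← Ring.descPochhammer_eq_factorial_smul_choose,
    ← descPochhammer_map (Int.castRingHom ℤ_[p]), eval_map, ← algebraMap_int_eq, ← aeval_def,
    aeval_eq_smeval]

theorem eval_choosePoly {k : ℕ} (hk : k < p) (x : ℤ_[p]) :
    (choosePoly p k).eval x = Ring.choose x k * Ring.choose (-1 - x) k := by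
  have h := natCast_mul_inverse (p := p)
    (fun h => hk.not_ge (((Fact.out : p.Prime).dvd_factorial).mp h))
  simp only [choosePoly, eval_mul, eval_pow, eval_C, eval_comp, eval_sub, eval_neg, eval_one,
    eval_X, eval_descPochhammer_eq_factorial_mul_choose]
  linear_combination Ring.choose x k * Ring.choose (-1 - x) k *
    ((k.factorial : ℤ_[p]) * Ring.inverse (k.factorial : ℤ_[p]) + 1) * h

theorem ring_choose_neg_one_sub_natCast (n k : ℕ) :
    Ring.choose (-1 - (n : ℤ_[p])) k = (-1) ^ k * ((n + k).choose k : ℤ_[p]) := by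
  rw [show (-1 - (n : ℤ_[p])) = -((n + 1 : ℕ) : ℤ_[p]) by push_cast; ring, Ring.choose_neg,
    show (((n + 1 : ℕ) : ℤ_[p]) + k - 1) = ((n + k : ℕ) : ℤ_[p]) by push_cast; ring,
    Ring.choose_natCast, Units.smul_def, Int.coe_negOnePow_natCast]
  simp

open Finset in
/-- At an integer `0 ≤ n < p` both sums have the value `p / (2n + 1)`. -/
theorem sum_mul_primeDivSucc_natCast {n : ℕ} (hn : n < p) (a : ℕ → ℤ_[p])
    (ha : ∀ k, a k = (-1) ^ k * (n.choose k : ℤ_[p]) * ((n + k).choose k : ℤ_[p])) :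
    ∑ i ∈ range p, ∑ j ∈ range p, a i * a j * primeDivSucc p (i + j) =
      ∑ k ∈ range p, a k * primeDivSucc p (2 * k) := by
  have hz : ∀ k ∉ range (n + 1), a k = 0 := fun k hk => by
    rw [ha, Nat.choose_eq_zero_of_lt (by simpa [Nat.lt_succ_iff] using hk)]; simp
  have hr : ∀ f : ℕ → ℤ_[p], (∀ k ∉ range (n + 1), f k = 0) →
      ∑ k ∈ range p, f k = ∑ k ∈ range (n + 1), f k := fun f hf =>
    (sum_subset (range_mono hn) fun k _ hk => hf k hk).symm
  rw [hr _ fun i hi => sum_eq_zero fun j _ => by rw [hz i hi]; simp,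
    hr _ fun i hi => by rw [hz i hi]; simp,
    sum_congr rfl fun i _ => hr _ fun j hj => by rw [hz j hj]; simp]
  have h1 := sum_choose_mul_choose_div_add_add_one (K := ℚ_[p]) n
  have h2 := sum_choose_mul_choose_div_two_mul_add_one (K := ℚ_[p]) n
  rw [← h2, sum_comm] at h1
  apply PadicInt.ext
  have h3 := congrArg (fun t => (p : ℚ_[p]) * t) h1
  simp only [mul_sum] at h3
  rw [PadicInt.coe_sum, PadicInt.coe_sum]
  convert h3 using 2 with i hi i hi
  · rw [PadicInt.coe_sum]
    refine sum_congr rfl fun j hj => ?_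
    rw [mem_range] at hi hj
    rw [PadicInt.coe_mul, PadicInt.coe_mul, coe_primeDivSucc (by omega), ha, ha]
    push_cast; ring
  · rw [mem_range] at hi
    rw [PadicInt.coe_mul, coe_primeDivSucc (by omega), ha]
    push_cast; ring

open Finset in
/-- The polynomial `∑ aᵢ aⱼ p / (i + j + 1) - ∑ aₖ p / (2k + 1)` with `aₖ = C(X, k) C(-1 - X, k)`
and all indices below `p`. -/
noncomputable def diffPoly (p : ℕ) [Fact p.Prime] : ℤ_[p][X] :=
  ∑ i ∈ range p, ∑ j ∈ range p, C (primeDivSucc p (i + j)) * (choosePoly p i * choosePoly p j) -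
    ∑ k ∈ range p, C (primeDivSucc p (2 * k)) * choosePoly p k

open Finset in
theorem eval_diffPoly (x : ℤ_[p]) : (diffPoly p).eval x =
    ∑ i ∈ range p, ∑ j ∈ range p, (Ring.choose x i * Ring.choose (-1 - x) i) *
      (Ring.choose x j * Ring.choose (-1 - x) j) * primeDivSucc p (i + j) -
    ∑ k ∈ range p, Ring.choose x k * Ring.choose (-1 - x) k * primeDivSucc p (2 * k) := by
  simp only [diffPoly, eval_sub, eval_finsetSum, eval_mul, eval_C]
  congr 1
  · refine sum_congr rfl fun i hi => sum_congr rfl fun j hj => ?_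
    rw [eval_choosePoly (mem_range.mp hi), eval_choosePoly (mem_range.mp hj)]; ring
  · refine sum_congr rfl fun i hi => ?_
    rw [eval_choosePoly (mem_range.mp hi)]; ring

theorem eval_diffPoly_natCast {n : ℕ} (hn : n < p) : (diffPoly p).eval (n : ℤ_[p]) = 0 := by
  rw [eval_diffPoly, sub_eq_zero]
  refine sum_mul_primeDivSucc_natCast hn (fun k => Ring.choose (n : ℤ_[p]) k *
    Ring.choose (-1 - (n : ℤ_[p])) k) fun k => ?_
  rw [Ring.choose_natCast, ring_choose_neg_one_sub_natCast]; ring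

theorem eval_diffPoly_neg_one_sub (x : ℤ_[p]) :
    (diffPoly p).eval (-1 - x) = (diffPoly p).eval x := by
  simp only [eval_diffPoly, sub_sub_cancel, mul_comm (Ring.choose (-1 - x) _)]

theorem eval_diffPoly_sub {m : ℕ} (hm : m < 2 * p) :
    (diffPoly p).eval ((m : ℤ_[p]) - p) = 0 := by
  rcases lt_or_ge m p with h | h
  · rw [← eval_diffPoly_neg_one_sub,
      show (-1 - ((m : ℤ_[p]) - p)) = ((p - 1 - m : ℕ) : ℤ_[p]) by
        rw [Nat.sub_sub, Nat.cast_sub (by omega)]; push_cast; ring]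
    exact eval_diffPoly_natCast (by omega)
  · rw [← Nat.cast_sub h]
    exact eval_diffPoly_natCast (by omega)

open Finset in
/-- Modulo `p`, only the terms with `i + j = p - 1` or `2 * k = p - 1` survive, and these have
degree at most `2 * (p - 1)`, although the degree over `ℤ_[p]` may be as large as `4 * (p - 1)`. -/
theorem degree_map_diffPoly_lt : ((diffPoly p).map PadicInt.toZMod).degree < (2 * p : ℕ) := by
  have hp := (Fact.out : p.Prime).pos
  have key : ∀ n d (f : ℤ_[p][X]), f.natDegree ≤ d → (n + 1 = p → d < 2 * p) →
      (C (primeDivSucc p n) * f).map PadicInt.toZMod ∈ degreeLT (ZMod p) (2 * p) := by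
    intro n d f hf hd
    rw [mem_degreeLT]
    by_cases h : n + 1 = p
    · refine degree_map_le.trans_lt ((degree_le_natDegree).trans_lt ?_)
      exact_mod_cast ((natDegree_C_mul_le _ _).trans hf).trans_lt (hd h)
    · rw [Polynomial.map_mul, map_C, (padicInt_dvd_iff_toZMod_eq_zero _).mp (dvd_primeDivSucc h),
        C_0, zero_mul, degree_zero]
      exact WithBot.bot_lt_coe _
  rw [← mem_degreeLT, diffPoly, Polynomial.map_sub, Polynomial.map_sum, Polynomial.map_sum]
  refine sub_mem (sum_mem fun i _ => ?_) (sum_mem fun k _ => ?_)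
  · rw [Polynomial.map_sum]
    refine sum_mem fun j _ => key (i + j) (2 * i + 2 * j) _ (natDegree_mul_le.trans ?_) (by omega)
    exact add_le_add (natDegree_choosePoly_le i) (natDegree_choosePoly_le j)
  · exact key (2 * k) (2 * k) _ (natDegree_choosePoly_le k) (by omega)

open Finset in
theorem nodal_dvd_diffPoly :
    Lagrange.nodal (range (2 * p)) (fun m : ℕ => (m : ℤ_[p]) - p) ∣ diffPoly p := by
  rcases eq_or_ne (diffPoly p) 0 with h | h
  · rw [h]; exact dvd_zero _
  have := (Multiset.prod_X_sub_C_dvd_iff_le_roots h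
    ((range (2 * p)).val.map (fun m : ℕ => (m : ℤ_[p]) - p))).mpr ?_
  · rw [Multiset.map_map] at this
    exact this
  · rw [Multiset.le_iff_subset]
    · intro y hy
      obtain ⟨m, hm, rfl⟩ := Multiset.mem_map.mp hy
      exact (mem_roots h).mpr (eval_diffPoly_sub (by simpa using hm))
    · exact (range (2 * p)).nodup.map fun a b hab => by simpa using hab

open Finset in
theorem prime_dvd_prod_sub_natCast (x : ℤ_[p]) : (p : ℤ_[p]) ∣ ∏ m ∈ range p, (x - m) := by
  rw [padicInt_dvd_iff_toZMod_eq_zero, map_prod]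
  refine prod_eq_zero (mem_range.mpr (PadicInt.toZMod x).val_lt) ?_
  rw [map_sub, map_natCast, ZMod.natCast_zmod_val, sub_self]

open Finset in
/-- The divisor `M = ∏_{-p ≤ m < p} (X - m)` of `diffPoly p` takes values divisible by `p ^ 2`, and
the cofactor vanishes modulo `p` by comparing degrees. -/
theorem prime_pow_three_dvd_eval_diffPoly (x : ℤ_[p]) : (p : ℤ_[p]) ^ 3 ∣ (diffPoly p).eval x := by
  obtain ⟨q, hq⟩ := nodal_dvd_diffPoly (p := p)
  set M := Lagrange.nodal (range (2 * p)) (fun m : ℕ => (m : ℤ_[p]) - p) with hM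
  have hMm : M.Monic := Lagrange.nodal_monic
  have hMd : (M.map (PadicInt.toZMod (p := p))).degree = (2 * p : ℕ) := by
    rw [hMm.degree_map, hM, Lagrange.degree_nodal, card_range]
  have hz : (diffPoly p).map PadicInt.toZMod = 0 :=
    eq_zero_of_dvd_of_degree_lt (Polynomial.map_dvd PadicInt.toZMod ⟨q, hq⟩)
      (hMd ▸ degree_map_diffPoly_lt)
  have hqz : q.map (PadicInt.toZMod (p := p)) = 0 := by
    rw [hq, Polynomial.map_mul] at hz
    exact (mul_eq_zero.mp hz).resolve_left (hMm.map _).ne_zero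
  have h1 : (p : ℤ_[p]) ∣ q.eval x := by
    rw [padicInt_dvd_iff_toZMod_eq_zero, ← eval_map_apply, hqz, eval_zero]
  have h2 : (p : ℤ_[p]) ^ 2 ∣ M.eval x := by
    rw [hM, Lagrange.eval_nodal, two_mul, prod_range_add, pow_two]
    refine mul_dvd_mul ?_ ?_
    · convert prime_dvd_prod_sub_natCast (x + (p : ℤ_[p])) using 2 with m
      ring
    · convert prime_dvd_prod_sub_natCast x using 2 with m
      push_cast; ring
  rw [hq, eval_mul, pow_succ]
  exact mul_dvd_mul h2 h1
end

end

/-! ### The congruence -/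

theorem theorem5p1 (p : ℕ) [Fact p.Prime] (hp : 3 < p) (x : ℤ_[p]) :
    PadicModEq p 3
      (((∑ k ∈ Finset.range p, smallS k x *
          ∑ j ∈ Finset.range p,
            Ring.choose x j * Ring.choose (-1 - x) j * ((k + j).choose j : ℤ_[p]) : ℤ_[p])) : ℚ_[p])
      (∑ k ∈ Finset.range p,
        ((Ring.choose x k : ℤ_[p]) : ℚ_[p]) * ((Ring.choose (-1 - x) k : ℤ_[p]) : ℚ_[p]) *
          ((p : ℚ_[p]) / (2 * (k : ℚ_[p]) + 1))) := by
  have h1 := prime_pow_three_dvd_sum_sub hp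
    (fun k => Ring.choose x k * Ring.choose (-1 - x) k)
  have h2 := prime_pow_three_dvd_eval_diffPoly x
  rw [eval_diffPoly] at h2
  obtain ⟨c, hc⟩ := dvd_add h1 h2
  rw [sub_add_sub_cancel] at hc
  refine ⟨c, ?_⟩
  have hR : ∑ k ∈ Finset.range p,
        ((Ring.choose x k : ℤ_[p]) : ℚ_[p]) * ((Ring.choose (-1 - x) k : ℤ_[p]) : ℚ_[p]) *
          ((p : ℚ_[p]) / (2 * (k : ℚ_[p]) + 1)) =
      ((∑ k ∈ Finset.range p,
        Ring.choose x k * Ring.choose (-1 - x) k * primeDivSucc p (2 * k) : ℤ_[p]) : ℚ_[p]) := by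
    rw [PadicInt.coe_sum]
    refine Finset.sum_congr rfl fun k hk => ?_
    rw [Finset.mem_range] at hk
    rw [PadicInt.coe_mul, PadicInt.coe_mul, coe_primeDivSucc (by omega)]
    push_cast; rfl
  have hL : ∀ k, smallS k x = ∑ i ∈ Finset.range (k + 1),
      (k.choose i : ℤ_[p]) * (Ring.choose x i * Ring.choose (-1 - x) i) * (-1) ^ i := fun k => by
    simp only [smallS, bigS, mul_assoc]
  simp only [hL]
  rw [hR, ← PadicInt.coe_sub, hc]
  push_cast; rfl
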